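/- Let $N\ge 1$ be an integer and let $U,V:\mathbb{R}\to\mathbb{C}$ be such that $U$ is differentiable on $(0,\infty)$ with $U'(r)=rV(r)$ for all $r>0$, $$\lim_{r\to0^+}U(r)\,r^{N}=0,\qquad \lim_{r\to\infty}U(r)\,r^{\frac{N-1}{2}}=0 .$$ Put $u(x)=U(|x|)$ on $\mathbb{R}^N$ and $v(y)=V(|y|)$ on $\mathbb{R}^{N+2}$, and let $\mathcal{F}_k(\phi)(\xi)=\int_{\mathbb{R}^k}\phi(x)e^{-2\pi i x\cdot\xi}\,dx$ be the Fourier transform on $\mathbb{R}^k$. More generally, for a measurable $\phi$ on $\mathbb{R}^k$ that is tempered (that is, $(1+|x|)^{-m}\phi\in L^1$ for some $m\in\mathbb{N}$), say that $\mathcal{F}_k(\phi)$ is well defined as the function $g$ if $g$ is also tempered and $\int\phi\,\mathcal{F}_k(\psi)=\int g\,\psi$ for all Schwartz functions $\psi$. For $s\ge0$ and such $\phi$, $\Delta^{s}\phi$ is said to be defined and equal to $w$ if $w$ is tempered and $\mathcal{F}_k(w)=(2\pi|\xi|)^{2s}\mathcal{F}_k(\phi)$ (so $\Delta^s$ stands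 for $(-\Delta)^s$; the sign plays no role below). 1. If $u\in L^1(\mathbb{R}^N)$ and $v\in L^1(\mathbb{R}^{N+2})$, then $\mathcal{F}_{N+2}(v)(\eta)=-2\pi\,\mathcal{F}_N(u)(\xi)$ for all $\xi\in\mathbb{R}^N$, $\eta\in\mathbb{R}^{N+2}$ with $|\eta|=|\xi|$. 2. If $\mathcal{F}_N(u)$ and $\mathcal{F}_{N+2}(v)$ are well defined as functions in the above general sense, then $\mathcal{F}_{N+2}(v)=-2\pi\mathcal{F}_N(u)$ as radial profiles: there is $\Phi:\mathbb{R}\to\mathbb{C}$ with $\mathcal{F}_N(u)(\xi)=\Phi(|\xi|)$ for a.e. $\xi\in\mathbb{R}^N$ and $\mathcal{F}_{N+2}(v)(\eta)=-2\pi\Phi(|\eta|)$ for a.e. $\eta\in\mathbb{R}^{N+2}$. 3. Under the assumption of 2, for every real $\alpha\ge0$: $\Delta^{\alpha+\frac12}u$ is defined and in $L^2(\mathbb{R}^N)$ if and only if $\Delta^{\alpha}v$ is defined and in $L^2(\mathbb{R}^{N+2})$; and whenever $\Delta^{\alpha+\frac12}u$ and $\Delta^\alpha v$ are both defined, $$\int_{\mathbb{R}^{N}}|\Delta^{\alpha+\frac12}u|^2\,dx=\frac{|\mathbb{S}^{N-1}|}{|\mathbb{S}^{N+1}|}\int_{\mathbb{R}^{N+2}}|\Delta^{\alpha}v|^2\,dx\quad\text{in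 }[0,\infty],$$ where $|\mathbb{S}^{k-1}|$ is the surface area of the unit sphere of $\mathbb{R}^k$. -/

import Mathlib

open MeasureTheory Filter Topology Set
open scoped FourierTransform SchwartzMap ENNReal

/-- The Euclidean space `ℝⁿ`. -/
abbrev Euc (n : ℕ) : Type := EuclideanSpace ℝ (Fin n)

/-- The radial function on `ℝⁿ` with profile `P`, `x ↦ P |x|`. -/
noncomputable def radialFun (n : ℕ) (P : ℝ → ℂ) : Euc n → ℂ := fun x => P ‖x‖

/-- `φ` is a (regular) tempered function: it is integrable against some negative power of
`1 + |x|`. This covers every `L^p`, `1 ≤ p ≤ ∞`, and sums of such functions. -/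
def IsTemperedFun {n : ℕ} (φ : Euc n → ℂ) : Prop :=
  ∃ k : ℕ, Integrable (fun x => (((1 + ‖x‖) ^ k)⁻¹ : ℝ) • φ x)

/-- The Fourier transform (normalised as `∫ φ(x) e^{-2πi x·ξ} dx`) of the tempered function `φ`
is well defined as the function `g`: the tempered distribution `𝓕 φ`, that is
`ψ ↦ ∫ φ 𝓕ψ`, is the one given by the tempered function `g`. -/
def HasFourier {n : ℕ} (φ g : Euc n → ℂ) : Prop :=
  IsTemperedFun φ ∧ IsTemperedFun g ∧
    ∀ ψ : 𝓢(Euc n, ℂ), ∫ x, φ x * (𝓕 ψ) x = ∫ ξ, g ξ * ψ ξ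

/-- The fractional Laplacian `Δ^s φ` (more precisely `(-Δ)^s φ`) is defined and is the function
`w`: the Fourier transform of `w` is `(2π|ξ|)^{2s}` times the Fourier transform of `φ`. -/
def HasFracLaplacian {n : ℕ} (s : ℝ) (φ w : Euc n → ℂ) : Prop :=
  ∃ g : Euc n → ℂ, HasFourier φ g ∧
    HasFourier w (fun ξ => (((2 * Real.pi * ‖ξ‖) ^ (2 * s) : ℝ) : ℂ) * g ξ)

/-- The surface area of the unit sphere `𝕊^{n-1}` of `ℝⁿ`. -/
noncomputable def sphereArea (n : ℕ) : ℝ≥0∞ :=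
  (volume : Measure (Euc n)).toSphere Set.univ

/-! Everything is tested against Gaussians. Write M_m(P, b) = ∫_0^∞ e^{-br²} r^m P(r) dr. Pairing a
radial function on ℝⁿ with e^{-b|x|²} gives a constant times M_{n-1}(P, b), and the Fourier
transform of a Gaussian is explicit. Hence, if P and Q are the profiles of a function and of its
transform, M_{n-1}(Q, b) = (π/b)^{n/2} M_{n-1}(P, π²/b) (`HasFourier.gaussMoment_eq`).

Let F and G be the profiles of the transforms of u and v. Since r^{N+1} V = r^N U', integration by
parts expresses M_{N+1}(V, c) through M_{N-1}(U, c) and M_{N+1}(U, c); the two limits kill the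
boundary terms (`gaussMoment_of_hasDerivAt`). Differentiating the identity between F and U in b
raises the moment index from N-1 to N+1 and produces the same combination at c = π²/b. This gives
M_{N+1}(G, b) = -2π M_{N+1}(F, b) for all b > 0. Gaussian moments determine a function by
Weierstrass approximation in e^{-r²}, so G = -2πF a.e. (`fourier_profile_eq`).

Profiles exist because the transform is invariant under each isometry and averaging over balls makes
it radial. For integrable u and v the profiles are continuous, which upgrades a.e. to everywhere.
The statements on fractional Laplacians follow from Plancherel and polar coordinates: the extra
multiplier (2πr)² in dimension N is the constant |-2π|² times the ratio r² of the radial densities.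
-/

/-! ### Gaussians as Schwartz functions -/

/-- Polynomial times Gaussian is bounded on the half line. -/
lemma exists_one_add_pow_mul_exp_le (k : ℕ) {b : ℝ} (hb : 0 < b) :
    ∃ C, ∀ r : ℝ, 0 ≤ r → (1 + r) ^ k * Real.exp (-b * r ^ 2) ≤ C := by
  -- The exponent is the maximum of k(1 + r) - br², attained at r = k/(2b).
  refine ⟨Real.exp (k + k ^ 2 / (4 * b)), fun r hr => ?_⟩
  have h1 : (1 + r) ^ k ≤ Real.exp (k * (1 + r)) := by
    rw [Real.exp_nat_mul]
    gcongr
    linarith [Real.add_one_le_exp (1 + r)]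
  calc (1 + r) ^ k * Real.exp (-b * r ^ 2)
      ≤ Real.exp (k * (1 + r)) * Real.exp (-b * r ^ 2) := by gcongr
    _ = Real.exp (k * (1 + r) + -b * r ^ 2) := by rw [Real.exp_add]
    _ ≤ _ := by
      apply Real.exp_le_exp.2
      have : (k : ℝ) + k ^ 2 / (4 * b) - (k * (1 + r) + -b * r ^ 2) =
          b * (r - k / (2 * b)) ^ 2 := by
        field_simp
        ring
      nlinarith [mul_nonneg hb.le (sq_nonneg (r - k / (2 * b)))]

/-- The Gaussian `exp (-b |x|²)` as a Schwartz function. -/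
noncomputable def gaussianSchwartz (n : ℕ) (b : ℝ) (hb : 0 < b) : 𝓢(Euc n, ℂ) where
  toFun x := ((Real.exp (-b * ‖x‖ ^ 2) : ℝ) : ℂ)
  smooth' := by
    apply Complex.ofRealCLM.contDiff.comp
    exact Real.contDiff_exp.comp (contDiff_const.mul (contDiff_norm_sq ℝ))
  decay' k n' := by
    have htg : (fun x : Euc n => -b * ‖x‖ ^ 2).HasTemperateGrowth :=
      (Function.HasTemperateGrowth.const (-b)).mul
        (Function.hasTemperateGrowth_norm_sq (H := Euc n))
    obtain ⟨m, C, hC, hbd⟩ := htg.norm_iteratedFDeriv_le_uniform n'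
    obtain ⟨B, hB⟩ := exists_one_add_pow_mul_exp_le (k + m * n') hb
    refine ⟨n'.factorial * (C + 1) ^ n' * B, fun x => ?_⟩
    have hsm : ContDiff ℝ ((⊤ : ℕ∞) : WithTop ℕ∞) (fun x : Euc n => -b * ‖x‖ ^ 2) :=
      contDiff_const.mul (contDiff_norm_sq ℝ)
    have hone : (1 : ℝ) ≤ (1 + ‖x‖) ^ m := one_le_pow₀ (by linarith [norm_nonneg x])
    have key : ‖iteratedFDeriv ℝ n' (Real.exp ∘ fun x : Euc n => -b * ‖x‖ ^ 2) x‖ ≤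
        n'.factorial * Real.exp (-b * ‖x‖ ^ 2) * ((C + 1) * (1 + ‖x‖) ^ m) ^ n' := by
      refine norm_iteratedFDeriv_comp_le (N := ((⊤ : ℕ∞) : WithTop ℕ∞)) Real.contDiff_exp hsm (mod_cast le_top) x ?_ ?_
      · intro i _
        rw [norm_iteratedFDeriv_eq_norm_iteratedDeriv, iteratedDeriv_eq_iterate,
          Real.iter_deriv_exp, Real.norm_of_nonneg (Real.exp_pos _).le]
      · intro i hi hin
        refine (hbd i hin x).trans ?_
        -- Using C + 1 instead of C makes the base at least 1, so passing to its i-th power, i ≥ 1,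
        -- only increases it.
        refine le_trans ?_ (le_self_pow₀ (by nlinarith) (by lia))
        gcongr
        linarith
    have h2 : ‖iteratedFDeriv ℝ n' (fun x : Euc n => ((Real.exp (-b * ‖x‖ ^ 2) : ℝ) : ℂ)) x‖ ≤
        ‖iteratedFDeriv ℝ n' (Real.exp ∘ fun x : Euc n => -b * ‖x‖ ^ 2) x‖ := by
      exact (LinearIsometry.norm_iteratedFDeriv_comp_left Complex.ofRealLI
        (Real.contDiff_exp.comp hsm).contDiffAt (mod_cast le_top)).le
    calc _ ≤ ‖x‖ ^ k * (n'.factorial * Real.exp (-b * ‖x‖ ^ 2) *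
          ((C + 1) * (1 + ‖x‖) ^ m) ^ n') := by
          gcongr
          exact h2.trans key
      _ ≤ (1 + ‖x‖) ^ k * (n'.factorial * Real.exp (-b * ‖x‖ ^ 2) *
          ((C + 1) * (1 + ‖x‖) ^ m) ^ n') := by
          gcongr
          linarith
      _ = n'.factorial * (C + 1) ^ n' *
          ((1 + ‖x‖) ^ (k + m * n') * Real.exp (-b * ‖x‖ ^ 2)) := by
          rw [mul_pow, ← pow_mul]
          ring
      _ ≤ _ := by
          gcongr
          exact hB _ (norm_nonneg x)

lemma gaussianSchwartz_apply (n : ℕ) (b : ℝ) (hb : 0 < b) (x : Euc n) :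
    gaussianSchwartz n b hb x = ((Real.exp (-b * ‖x‖ ^ 2) : ℝ) : ℂ) := rfl

lemma fourier_gaussianSchwartz (n : ℕ) (b : ℝ) (hb : 0 < b) (w : Euc n) :
    (𝓕 (gaussianSchwartz n b hb)) w =
      (((Real.pi / b) ^ ((n : ℝ) / 2) : ℝ) : ℂ) *
        ((Real.exp (-(Real.pi ^ 2 / b) * ‖w‖ ^ 2) : ℝ) : ℂ) := by
  have h := fourier_gaussian_innerProductSpace (V := Euc n) (b := (b : ℂ)) (by simpa) w
  rw [SchwartzMap.fourier_coe]
  have : (gaussianSchwartz n b hb : Euc n → ℂ) = fun v => Complex.exp (-(b : ℂ) * ‖v‖ ^ 2) := by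
    ext v
    simp [gaussianSchwartz_apply]
  rw [this, h, Complex.ofReal_cpow (by positivity)]
  simp
  left
  congr 1
  ring

/-! ### Tempered functions, uniqueness of the transform and Plancherel -/

section HasFourier

variable {n : ℕ} {φ φ' g g' : Euc n → ℂ}

lemma one_add_norm_pow_ne_zero (k : ℕ) (x : Euc n) : (1 + ‖x‖) ^ k ≠ 0 := by positivity

lemma IsTemperedFun.locallyIntegrable (h : IsTemperedFun φ) : LocallyIntegrable φ := by
  obtain ⟨k, hk⟩ := h
  rw [← locallyIntegrableOn_univ]
  have h1 := (locallyIntegrableOn_univ.2 hk.locallyIntegrable).continuousOn_smul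
    isOpen_univ.isLocallyClosed (g := fun x : Euc n => (1 + ‖x‖) ^ k) (by fun_prop)
  convert h1 using 2 with x
  rw [smul_inv_smul₀ (one_add_norm_pow_ne_zero k x)]

lemma IsTemperedFun.aestronglyMeasurable (h : IsTemperedFun φ) : AEStronglyMeasurable φ :=
  h.locallyIntegrable.aestronglyMeasurable

lemma IsTemperedFun.congr (h : IsTemperedFun φ) (he : φ =ᵐ[volume] φ') : IsTemperedFun φ' := by
  obtain ⟨k, hk⟩ := h
  refine ⟨k, hk.congr ?_⟩
  filter_upwards [he] with x hx
  rw [hx]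

lemma MeasureTheory.Integrable.isTemperedFun (h : Integrable φ) : IsTemperedFun φ :=
  ⟨0, by simpa using h⟩

lemma integrable_inv_one_add_norm_pow (n k : ℕ) (hk : n < k) :
    Integrable (fun x : Euc n => ((1 + ‖x‖) ^ k)⁻¹) := by
  have := integrable_one_add_norm (E := Euc n) (μ := volume) (r := k) (by simpa using hk)
  refine this.congr (Eventually.of_forall fun x => ?_)
  simp only
  rw [Real.rpow_neg (by positivity), Real.rpow_natCast]

lemma isTemperedFun_of_bounded (hm : AEStronglyMeasurable φ) (C : ℝ) (hC : ∀ x, ‖φ x‖ ≤ C) :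
    IsTemperedFun φ := by
  refine ⟨n + 1, ?_⟩
  simp only [Complex.real_smul]
  exact (integrable_inv_one_add_norm_pow n (n + 1) (by lia)).ofReal.mul_bdd hm
    (c := C) (Eventually.of_forall hC)

lemma MeasureTheory.MemLp.isTemperedFun (h : MemLp φ 2) : IsTemperedFun φ := by
  refine ⟨n + 1, ?_⟩
  have h1 : MemLp (fun x : Euc n => ((1 + ‖x‖) ^ (n + 1))⁻¹) 2 := by
    rw [memLp_two_iff_integrable_sq]
    · refine (integrable_inv_one_add_norm_pow n ((n + 1) * 2) (by lia)).congr
        (Eventually.of_forall fun x => ?_)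
      simp only
      rw [inv_pow, ← pow_mul]
    · exact (integrable_inv_one_add_norm_pow n (n + 1) (by lia)).aestronglyMeasurable
  exact memLp_one_iff_integrable.1 (h.smul h1 (r := 1))

lemma HasFourier.congr (h : HasFourier φ g) (h1 : φ =ᵐ[volume] φ') (h2 : g =ᵐ[volume] g') :
    HasFourier φ' g' := by
  refine ⟨h.1.congr h1, h.2.1.congr h2, fun ψ => ?_⟩
  have e1 : ∫ x, φ' x * (𝓕 ψ) x = ∫ x, φ x * (𝓕 ψ) x :=
    integral_congr_ae (by filter_upwards [h1] with x hx; rw [hx])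
  have e2 : ∫ x, g' x * ψ x = ∫ x, g x * ψ x :=
    integral_congr_ae (by filter_upwards [h2] with x hx; rw [hx])
  rw [e1, e2, h.2.2 ψ]

lemma IsTemperedFun.ae_eq_of_integral_schwartz (h : IsTemperedFun φ) (h' : IsTemperedFun φ')
    (heq : ∀ ψ : 𝓢(Euc n, ℂ), ∫ x, φ x * ψ x = ∫ x, φ' x * ψ x) : φ =ᵐ[volume] φ' := by
  refine ae_eq_of_integral_contDiff_smul_eq h.locallyIntegrable h'.locallyIntegrable
    fun p hp hc => ?_
  have hg₁ : HasCompactSupport (Complex.ofRealCLM ∘ p) := hc.comp_left rfl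
  have hg₂ : ContDiff ℝ ((⊤ : ℕ∞) : WithTop ℕ∞) (Complex.ofRealCLM ∘ p) := by fun_prop
  simpa [mul_comm] using heq (hg₁.toSchwartzMap hg₂)

lemma HasFourier.unique_right (h : HasFourier φ g) (h' : HasFourier φ g') : g =ᵐ[volume] g' :=
  h.2.1.ae_eq_of_integral_schwartz h'.2.1 fun ψ => by rw [← h.2.2, ← h'.2.2]

/-- Testing with 𝓕⁻ψ turns the pairing with 𝓕 into a pairing with an arbitrary Schwartz function. -/
lemma HasFourier.unique_left (h : HasFourier φ g) (h' : HasFourier φ' g) : φ =ᵐ[volume] φ' :=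
  h.1.ae_eq_of_integral_schwartz h'.1 fun ψ => by
    have := (h.2.2 (𝓕⁻ ψ)).trans (h'.2.2 (𝓕⁻ ψ)).symm
    simpa using this

lemma hasFourier_Lp (f : Lp (α := Euc n) ℂ 2) :
    HasFourier (f : Euc n → ℂ) ((𝓕 f : Lp (α := Euc n) ℂ 2) : Euc n → ℂ) := by
  refine ⟨(Lp.memLp f).isTemperedFun, (Lp.memLp _).isTemperedFun, fun ψ => ?_⟩
  have := congrArg (fun T => T ψ) (Lp.fourier_toTemperedDistribution_eq f)
  simpa [TemperedDistribution.fourier_apply, mul_comm] using this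

lemma MeasureTheory.MemLp.exists_hasFourier_left (h : MemLp g 2) :
    ∃ w : Euc n → ℂ, MemLp w 2 ∧ HasFourier w g := by
  obtain ⟨w, hw⟩ : ∃ w : Lp ℂ 2 (volume : Measure (Euc n)), 𝓕 w = h.toLp g :=
    ⟨𝓕⁻ (h.toLp g), FourierTransform.fourier_fourierInv_eq _⟩
  refine ⟨w, Lp.memLp _, (hasFourier_Lp w).congr EventuallyEq.rfl ?_⟩
  rw [hw]
  exact h.coeFn_toLp

lemma HasFourier.memLp_right (h : HasFourier φ g) (hφ : MemLp φ 2) : MemLp g 2 := by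
  have h1 := (hasFourier_Lp (hφ.toLp φ)).congr hφ.coeFn_toLp EventuallyEq.rfl
  exact (memLp_congr_ae (h.unique_right h1)).2 (Lp.memLp _)

lemma HasFourier.memLp_left (h : HasFourier φ g) (hg : MemLp g 2) : MemLp φ 2 := by
  obtain ⟨w, hw, hwg⟩ := hg.exists_hasFourier_left
  exact (memLp_congr_ae (h.unique_left hwg)).2 hw

/-- On L² this is Plancherel. Membership in L² passes in both directions, so otherwise both norms
are infinite. -/
lemma HasFourier.eLpNorm_eq (h : HasFourier φ g) : eLpNorm φ 2 = eLpNorm g 2 := by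
  by_cases hφ : MemLp φ 2
  · have h1 := (hasFourier_Lp (hφ.toLp φ)).congr hφ.coeFn_toLp EventuallyEq.rfl
    rw [eLpNorm_congr_ae (h.unique_right h1), ← Lp.enorm_def, ← eLpNorm_congr_ae hφ.coeFn_toLp,
      ← Lp.enorm_def, ← ofReal_norm, ← ofReal_norm, Lp.norm_fourier_eq]
  · have hg : ¬ MemLp g 2 := fun hg => hφ (h.memLp_left hg)
    have e1 : eLpNorm φ 2 = ∞ := by
      by_contra hne
      exact hφ ⟨h.1.aestronglyMeasurable, lt_top_iff_ne_top.2 hne⟩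
    have e2 : eLpNorm g 2 = ∞ := by
      by_contra hne
      exact hg ⟨h.2.1.aestronglyMeasurable, lt_top_iff_ne_top.2 hne⟩
    rw [e1, e2]

lemma eLpNorm_two_sq (φ : Euc n → ℂ) : eLpNorm φ 2 ^ 2 = ∫⁻ x, ‖φ x‖ₑ ^ 2 := by
  rw [eLpNorm_eq_lintegral_rpow_enorm_toReal (by norm_num) (by norm_num)]
  simp only [ENNReal.toReal_ofNat, ENNReal.rpow_ofNat]
  rw [← ENNReal.rpow_natCast, ← ENNReal.rpow_mul]
  norm_num

/-- Plancherel's theorem for tempered functions, with values in `[0, ∞]`. -/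
lemma HasFourier.lintegral_sq_eq (h : HasFourier φ g) :
    ∫⁻ x, ‖φ x‖ₑ ^ 2 = ∫⁻ x, ‖g x‖ₑ ^ 2 := by
  rw [← eLpNorm_two_sq, ← eLpNorm_two_sq, h.eLpNorm_eq]

lemma memLp_two_iff (hm : AEStronglyMeasurable φ) : MemLp φ 2 ↔ ∫⁻ x, ‖φ x‖ₑ ^ 2 < ∞ := by
  rw [← eLpNorm_two_sq]
  simp [MemLp, hm]

lemma MeasureTheory.Integrable.continuous_fourier (h : Integrable φ) : Continuous (𝓕 φ) :=
  VectorFourier.fourierIntegral_continuous Real.continuous_fourierChar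
    (innerSL ℝ).continuous₂ h

lemma MeasureTheory.Integrable.hasFourier (h : Integrable φ) : HasFourier φ (𝓕 φ) := by
  refine ⟨h.isTemperedFun, ?_, fun ψ => ?_⟩
  · refine isTemperedFun_of_bounded h.continuous_fourier.aestronglyMeasurable (∫ x, ‖φ x‖)
      fun x => ?_
    exact VectorFourier.norm_fourierIntegral_le_integral_norm _ _ _ _ _
  · rw [SchwartzMap.fourier_coe]
    symm
    have := VectorFourier.integral_fourierIntegral_smul_eq_flip (L := innerₗ (Euc n))
      (μ := volume) (ν := volume) Real.continuous_fourierChar continuous_inner h ψ.integrable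
    simpa [flip_innerₗ] using! this

/-- The transform commutes with isometries, so an invariance of φ can be moved onto the test
function. With `HasFourier.unique_right` it makes the transform a.e. invariant. -/
lemma HasFourier.comp_linearIsometryEquiv (h : HasFourier φ g) (A : Euc n ≃ₗᵢ[ℝ] Euc n)
    (hφ : ∀ x, φ (A x) = φ x) : HasFourier φ (fun x => g (A x)) := by
  refine ⟨h.1, ?_, fun ψ => ?_⟩
  · obtain ⟨k, hk⟩ := h.2.1
    refine ⟨k, ?_⟩
    have := A.measurePreserving.integrable_comp_of_integrable hk
    simpa [Function.comp_def] using this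
  · let ψ' : 𝓢(Euc n, ℂ) :=
      SchwartzMap.compCLMOfContinuousLinearEquiv ℂ A.symm.toContinuousLinearEquiv ψ
    have h1 : (ψ' : Euc n → ℂ) = ψ ∘ A.symm := rfl
    have h2 := h.2.2 ψ'
    have e1 : ∫ x, g (A x) * ψ x = ∫ x, g x * ψ' x := by
      rw [← A.measurePreserving.integral_comp A.toHomeomorph.measurableEmbedding
        (fun x => g x * ψ' x)]
      simp [h1]
    have e2 : ∫ x, φ x * (𝓕 ψ) x = ∫ x, φ x * (𝓕 ψ') x := by
      rw [← A.measurePreserving.integral_comp A.toHomeomorph.measurableEmbedding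
        (fun x => φ x * (𝓕 ψ' : 𝓢(Euc n, ℂ)) x)]
      congr with x
      rw [hφ, SchwartzMap.fourier_coe, SchwartzMap.fourier_coe, h1,
        Real.fourier_comp_linearIsometry, A.symm_apply_apply]
    rw [e1, e2, h2]

end HasFourier

/-! ### Polar coordinates and a.e. radial functions -/

section Polar

variable {n : ℕ}

/-- Polar coordinates, as the image of Lebesgue measure under the norm. -/
lemma map_norm_volume (hn : 1 ≤ n) :
    (volume : Measure (Euc n)).map (fun x => ‖x‖) =
      sphereArea n • (volume.restrict (Ioi 0)).withDensity (fun r => ENNReal.ofReal (r ^ (n - 1))) := by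
  have : Nonempty (Fin n) := ⟨⟨0, hn⟩⟩
  have hm : Measurable fun r : ℝ => ENNReal.ofReal (r ^ (n - 1)) := by fun_prop
  refine Measure.ext_of_lintegral _ fun F hF => ?_
  rw [lintegral_map hF measurable_norm, lintegral_smul_measure,
    lintegral_withDensity_eq_lintegral_mul _ hm hF]
  calc ∫⁻ x : Euc n, F ‖x‖
      = ∫⁻ x : ({(0)}ᶜ : Set (Euc n)), F ‖x.1‖ ∂((volume : Measure (Euc n)).comap Subtype.val) := by
        rw [lintegral_subtype_comap (measurableSet_singleton _).compl fun x : Euc n => F ‖x‖,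
          restrict_compl_singleton]
    _ = ∫⁻ x, F x.2 ∂(volume : Measure (Euc n)).toSphere.prod
          (.volumeIoiPow (Module.finrank ℝ (Euc n) - 1)) := by
        have := (volume : Measure (Euc n)).measurePreserving_homeomorphUnitSphereProd.lintegral_comp
          (f := fun p => F p.2) (by fun_prop)
        simpa using this
    _ = sphereArea n * ∫⁻ r : Ioi (0 : ℝ), F r ∂.volumeIoiPow (n - 1) := by
        rw [lintegral_prod _ (by fun_prop)]
        simp only [lintegral_const, finrank_euclideanSpace, Fintype.card_fin]
        rw [mul_comm, sphereArea]
    _ = _ := by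
        rw [Measure.volumeIoiPow, lintegral_withDensity_eq_lintegral_mul _ (by fun_prop)
          (by fun_prop), smul_eq_mul]
        congr 1
        exact lintegral_subtype_comap measurableSet_Ioi
          (fun r => ENNReal.ofReal (r ^ (n - 1)) * F r)

lemma sphereArea_ne_top (n : ℕ) : sphereArea n ≠ ∞ := measure_ne_top _ _

lemma sphereArea_ne_zero (hn : 1 ≤ n) : sphereArea n ≠ 0 := by
  have : Nonempty (Fin n) := ⟨⟨0, hn⟩⟩
  rw [sphereArea, Measure.measure_univ_ne_zero]
  exact Measure.toSphere_ne_zero _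

lemma ae_norm_of_ae_Ioi (hn : 1 ≤ n) {p : ℝ → Prop} (h : ∀ᵐ r ∂volume.restrict (Ioi 0), p r) :
    ∀ᵐ x : Euc n, p ‖x‖ := by
  refine ae_of_ae_map (f := fun x : Euc n => ‖x‖) measurable_norm.aemeasurable ?_
  rw [map_norm_volume hn]
  exact Measure.ae_smul_measure ((withDensity_absolutelyContinuous _ _).ae_le h) _

lemma lintegral_norm (hn : 1 ≤ n) {F : ℝ → ℝ≥0∞} (hF : AEMeasurable F (volume.restrict (Ioi 0))) :
    ∫⁻ x : Euc n, F ‖x‖ =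
      sphereArea n * ∫⁻ r in Ioi (0 : ℝ), ENNReal.ofReal (r ^ (n - 1)) * F r := by
  have h1 : AEMeasurable F ((volume : Measure (Euc n)).map (fun x => ‖x‖)) := by
    rw [map_norm_volume hn]
    exact (hF.mono_ac (withDensity_absolutelyContinuous _ _)).smul_measure _
  rw [← lintegral_map' h1 measurable_norm.aemeasurable, map_norm_volume hn,
    lintegral_smul_measure, smul_eq_mul,
    lintegral_withDensity_eq_lintegral_mul₀' (by fun_prop)
      (hF.mono_ac (withDensity_absolutelyContinuous _ _))]
  rfl

/-- Linear isometries act transitively on spheres. -/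
lemma exists_linearIsometryEquiv_apply_eq {x y : Euc n} (h : ‖x‖ = ‖y‖) :
    ∃ A : Euc n ≃ₗᵢ[ℝ] Euc n, A x = y :=
  ⟨_, Submodule.reflection_sub h⟩

/-- A locally integrable function that is a.e. invariant under each linear isometry is a.e. radial:
its averages over balls are radial, and they converge to it almost everywhere. -/
lemma exists_radial_of_ae_invariant {f : Euc n → ℂ} (hn : 1 ≤ n) (hf : LocallyIntegrable f)
    (hinv : ∀ A : Euc n ≃ₗᵢ[ℝ] Euc n, (fun x => f (A x)) =ᵐ[volume] f) :
    ∃ Φ : ℝ → ℂ, f =ᵐ[volume] radialFun n Φ := by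
  let av : ℝ → Euc n → ℂ := fun ε x => ⨍ y in Metric.closedBall x ε, f y
  have hav : ∀ ε (A : Euc n ≃ₗᵢ[ℝ] Euc n) x, av ε (A x) = av ε x := by
    intro ε A x
    have hpre : A ⁻¹' Metric.closedBall (A x) ε = Metric.closedBall x ε := by
      ext y
      simp
    simp only [av, setAverage_eq]
    congr 1
    · rw [measureReal_def, measureReal_def, ← hpre,
        A.measurePreserving.measure_preimage_emb A.toHomeomorph.measurableEmbedding]
    · rw [← A.measurePreserving.setIntegral_preimage_emb A.toHomeomorph.measurableEmbedding f, hpre]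
      exact integral_congr_ae (ae_restrict_of_ae (hinv A))
  let e : Euc n := EuclideanSpace.single ⟨0, hn⟩ 1
  have hlim := IsUnifLocDoublingMeasure.ae_tendsto_average volume hf 1
  -- The exceptional null set in `hinv` depends on A, so f itself cannot be read off along a ray;
  -- its averages are invariant at every point. Where the limit fails to exist the value is
  -- irrelevant.
  refine ⟨fun r => limUnder (𝓝[>] (0 : ℝ)) fun ε => av ε (r • e), ?_⟩
  filter_upwards [hlim] with x hx
  have h1 : Tendsto (fun ε => av ε x) (𝓝[>] 0) (𝓝 (f x)) :=
    hx (fun _ => x) id tendsto_id (by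
      filter_upwards [self_mem_nhdsWithin] with ε hε
      simp only [one_mul, id, Metric.mem_closedBall, dist_self]
      exact le_of_lt hε)
  obtain ⟨A, hA⟩ := exists_linearIsometryEquiv_apply_eq (x := x) (y := ‖x‖ • e) (by
    simp [e, norm_smul])
  rw [radialFun, ← hA]
  simp only [hav]
  exact h1.limUnder_eq.symm

lemma HasFourier.exists_radial {P : ℝ → ℂ} {f : Euc n → ℂ} (hn : 1 ≤ n)
    (h : HasFourier (radialFun n P) f) : ∃ Φ : ℝ → ℂ, f =ᵐ[volume] radialFun n Φ :=
  exists_radial_of_ae_invariant hn h.2.1.locallyIntegrable fun A =>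
    (h.comp_linearIsometryEquiv A fun x => by simp [radialFun]).unique_right h

end Polar

/-! ### Gaussian moments on the half line -/

section HalfLine

/-- Tempered functions on the half line `(0, ∞)`. -/
def IsTemperedIoi (h : ℝ → ℂ) : Prop :=
  ∃ k : ℕ, IntegrableOn (fun r => (((1 + r) ^ k)⁻¹ : ℝ) • h r) (Ioi 0)

variable {h h' : ℝ → ℂ}

lemma integrableOn_smul_of_bounded {k : ℕ}
    (hk : IntegrableOn (fun r => (((1 + r) ^ k)⁻¹ : ℝ) • h r) (Ioi 0)) {c : ℝ → ℝ}
    (hc : Measurable c) {C : ℝ} (hC : ∀ r, 0 < r → |c r| * (1 + r) ^ k ≤ C) :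
    IntegrableOn (fun r => c r • h r) (Ioi 0) := by
  have h1 : IntegrableOn (fun r => (((c r * (1 + r) ^ k : ℝ)) : ℂ) *
      ((((1 + r) ^ k)⁻¹ : ℝ) • h r)) (Ioi 0) := by
    refine Integrable.bdd_mul hk (c := C) ?_ ?_
    · exact (Complex.measurable_ofReal.comp (by fun_prop)).aestronglyMeasurable
    · filter_upwards [ae_restrict_mem measurableSet_Ioi] with r hr
      have hr' : (0 : ℝ) < r := hr
      rw [Complex.norm_real, Real.norm_eq_abs, abs_mul, abs_of_nonneg (a := (1 + r) ^ k)
        (by positivity)]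
      exact hC r hr
  refine h1.congr_fun (fun r hr => ?_) measurableSet_Ioi
  have hr' : (0 : ℝ) < r := hr
  have : ((1 + r : ℝ) : ℂ) ^ k ≠ 0 := by
    rw [← Complex.ofReal_pow, Complex.ofReal_ne_zero]
    positivity
  simp only [Complex.real_smul]
  push_cast at this ⊢
  field_simp

lemma IsTemperedIoi.pow_smul (hh : IsTemperedIoi h) (m : ℕ) :
    IsTemperedIoi fun r => (r ^ m : ℝ) • h r := by
  obtain ⟨k, hk⟩ := hh
  refine ⟨k + m, ?_⟩
  simp only [smul_smul]
  refine integrableOn_smul_of_bounded hk (by fun_prop) (C := 1) fun r hr => ?_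
  rw [abs_of_nonneg (by positivity), pow_add, mul_inv]
  have : r ^ m ≤ (1 + r) ^ m := by gcongr; linarith
  calc _ = r ^ m / (1 + r) ^ m := by field_simp
    _ ≤ 1 := div_le_one_of_le₀ this (by positivity)

lemma IsTemperedIoi.const_smul (hh : IsTemperedIoi h) (c : ℂ) :
    IsTemperedIoi fun r => c * h r := by
  obtain ⟨k, hk⟩ := hh
  refine ⟨k, (hk.const_mul c).congr (Eventually.of_forall fun r => ?_)⟩
  simp only [Complex.real_smul]
  ring

lemma IsTemperedIoi.add (hh : IsTemperedIoi h) (hh' : IsTemperedIoi h') :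
    IsTemperedIoi fun r => h r + h' r := by
  have mono : ∀ {g : ℝ → ℂ} {k : ℕ} (_ : IntegrableOn (fun r => (((1 + r) ^ k)⁻¹ : ℝ) • g r)
      (Ioi 0)) (l : ℕ), IntegrableOn (fun r => (((1 + r) ^ (k + l))⁻¹ : ℝ) • g r) (Ioi 0) := by
    intro g k hg l
    refine integrableOn_smul_of_bounded hg (by fun_prop) (C := 1) fun r hr => ?_
    rw [abs_of_nonneg (by positivity), pow_add]
    calc _ = 1 / (1 + r) ^ l := by field_simp
      _ ≤ 1 := div_le_one_of_le₀ (one_le_pow₀ (by linarith)) (by positivity)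
  obtain ⟨k, hk⟩ := hh
  obtain ⟨l, hl⟩ := hh'
  refine ⟨k + l, ?_⟩
  have h2 := mono hl k
  rw [add_comm l k] at h2
  refine ((mono hk l).add h2).congr (Eventually.of_forall fun r => ?_)
  simp only [Pi.add_apply, smul_add]

lemma IsTemperedIoi.integrableOn_gaussian_smul (hh : IsTemperedIoi h) {b : ℝ} (hb : 0 < b) :
    IntegrableOn (fun r => Real.exp (-b * r ^ 2) • h r) (Ioi 0) := by
  obtain ⟨k, hk⟩ := hh
  obtain ⟨C, hC⟩ := exists_one_add_pow_mul_exp_le k hb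
  refine integrableOn_smul_of_bounded hk (by fun_prop) (C := C) fun r hr => ?_
  rw [abs_of_nonneg (Real.exp_pos _).le, mul_comm]
  exact hC r hr.le

/-- Gaussian moments of a function on the half line. -/
noncomputable def gaussMoment (m : ℕ) (P : ℝ → ℂ) (b : ℝ) : ℂ :=
  ∫ r in Ioi (0 : ℝ), Real.exp (-b * r ^ 2) • ((r ^ m : ℝ) • P r)

/-- Differentiating e^{-br²} under the integral brings down -r². The parameter stays above b/2, so
the Gaussian with parameter b/2 dominates. -/
lemma hasDerivAt_gaussMoment {m : ℕ} {P : ℝ → ℂ}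
    (hP : IsTemperedIoi fun r => (r ^ m : ℝ) • P r) {b : ℝ} (hb : 0 < b) :
    HasDerivAt (gaussMoment m P) (-gaussMoment (m + 2) P b) b := by
  have key := hasDerivAt_integral_of_dominated_loc_of_deriv_le (𝕜 := ℝ)
    (μ := volume.restrict (Ioi (0 : ℝ)))
    (F := fun b r => Real.exp (-b * r ^ 2) • ((r ^ m : ℝ) • P r))
    (F' := fun b r => (Real.exp (-b * r ^ 2) * (-r ^ 2)) • ((r ^ m : ℝ) • P r))
    (bound := fun r => ‖Real.exp (-(b / 2) * r ^ 2) • ((r ^ 2 : ℝ) • ((r ^ m : ℝ) • P r))‖)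
    (x₀ := b) (s := Ioi (b / 2)) (Ioi_mem_nhds (by linarith)) ?_ ?_ ?_ ?_ ?_ ?_
  · have e : -gaussMoment (m + 2) P b = ∫ r in Ioi (0 : ℝ),
        (Real.exp (-b * r ^ 2) * (-r ^ 2)) • ((r ^ m : ℝ) • P r) := by
      unfold gaussMoment
      rw [← integral_neg]
      congr with r
      simp only [smul_smul, ← neg_smul]
      congr 1
      ring
    rw [e]
    exact key.2
  · filter_upwards [Ioi_mem_nhds hb] with x hx
    exact (hP.integrableOn_gaussian_smul hx).aestronglyMeasurable
  · exact hP.integrableOn_gaussian_smul hb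
  · have := ((hP.pow_smul 2).integrableOn_gaussian_smul hb).aestronglyMeasurable.neg
    refine this.congr (Eventually.of_forall fun r => ?_)
    simp only [Pi.neg_apply, smul_smul, ← neg_smul]
    congr 1
    ring
  · refine Eventually.of_forall fun r x hx => ?_
    rw [smul_smul (Real.exp (-(b / 2) * r ^ 2)), norm_smul, norm_smul _ ((r ^ m : ℝ) • P r)]
    gcongr ?_ * _
    rw [Real.norm_eq_abs, Real.norm_eq_abs, abs_mul, abs_mul, abs_neg, Real.abs_exp, Real.abs_exp]
    gcongr
    exact le_of_lt hx
  · exact ((hP.pow_smul 2).integrableOn_gaussian_smul (half_pos hb)).norm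
  · refine Eventually.of_forall fun r x _ => ?_
    have h1 : HasDerivAt (fun x : ℝ => -x * r ^ 2) (-r ^ 2) x := by
      simpa using (hasDerivAt_id x).neg.mul_const (r ^ 2)
    exact (h1.exp).smul_const _

/-- Functions on the half line are determined by their Gaussian moments. -/
lemma IsTemperedIoi.ae_eq_zero_of_gaussMoment (hh : IsTemperedIoi h)
    (hz : ∀ b : ℝ, 0 < b → ∫ r in Ioi (0 : ℝ), Real.exp (-b * r ^ 2) • h r = 0) :
    ∀ᵐ r ∂volume.restrict (Ioi 0), h r = 0 := by
  -- One Gaussian factor is spent to make h integrable; the remaining ones are powers of s = e^{-r²}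
  -- ∈ [0, 1], to which Weierstrass approximation applies.
  let g : ℝ → ℂ := fun r => Real.exp (-1 * r ^ 2) • h r
  have hg : IntegrableOn g (Ioi 0) := hh.integrableOn_gaussian_smul one_pos
  -- vanishing against polynomials in `exp (-r²)`
  have hpow : ∀ k : ℕ, ∫ r in Ioi (0 : ℝ), (Real.exp (-r ^ 2)) ^ k • g r = 0 := by
    intro k
    rw [← hz (k + 1) (by positivity)]
    congr with r
    rw [smul_smul, ← Real.exp_nat_mul, ← Real.exp_add]
    congr 2
    ring
  have hle : ∀ r : ℝ, Real.exp (-r ^ 2) ∈ Icc (0 : ℝ) 1 := fun r =>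
    ⟨(Real.exp_pos _).le, Real.exp_le_one_iff.2 (by nlinarith)⟩
  have hint : ∀ c : ℝ → ℝ, Measurable c → (∃ C, ∀ r, |c r| ≤ C) →
      IntegrableOn (fun r => c r • g r) (Ioi 0) := by
    rintro c hc ⟨C, hC⟩
    simp only [Complex.real_smul]
    refine Integrable.bdd_mul hg (c := C) ?_ (Eventually.of_forall fun r => ?_)
    · exact (Complex.measurable_ofReal.comp hc).aestronglyMeasurable
    · simpa using hC r
  have hpoly : ∀ q : Polynomial ℝ, ∫ r in Ioi (0 : ℝ), q.eval (Real.exp (-r ^ 2)) • g r = 0 := by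
    intro q
    simp only [Polynomial.eval_eq_sum_range, Finset.sum_smul, mul_smul]
    rw [integral_finsetSum]
    · simp only [integral_smul, hpow, smul_zero, Finset.sum_const_zero]
    · intro i _
      refine (hint (fun r => (Real.exp (-r ^ 2)) ^ i) (by fun_prop) ⟨1, fun r => ?_⟩).smul _
      rw [abs_of_nonneg (by positivity)]
      exact pow_le_one₀ (hle r).1 (hle r).2
  have hmain : ∀ᵐ r, r ∈ Ioi (0 : ℝ) → g r = 0 := by
    refine isOpen_Ioi.ae_eq_zero_of_integral_contDiff_smul_eq_zero hg.locallyIntegrableOn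
      fun φ hφ hc hs => ?_
    have hφ0 : ∀ r, r ≤ 0 → φ r = 0 := fun r hr =>
      image_eq_zero_of_notMem_tsupport fun hmem => absurd (hs hmem) (not_lt.2 hr)
    have hφcont : Continuous φ := hφ.continuous
    rw [← setIntegral_eq_integral_of_forall_compl_eq_zero (s := Ioi 0)
      (fun r hr => by rw [hφ0 r (not_lt.1 hr), zero_smul])]
    -- `φ` as a continuous function of `exp (-r²)`
    let c : ℝ → ℝ := fun s => φ (Real.sqrt (-Real.log s))
    have hceq : ∀ r : ℝ, 0 < r → c (Real.exp (-r ^ 2)) = φ r := by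
      intro r hr
      simp only [c, Real.log_exp, neg_neg, Real.sqrt_sq hr.le]
    have hccont : ContinuousOn c (Icc 0 1) := by
      intro s hs'
      rcases hs'.1.eq_or_lt with rfl | hpos
      -- The convention log 0 = 0 gives c 0 = φ 0 = 0. This is the right value: s → 0 corresponds to
      -- r → ∞, outside the compact support of φ.
      · have hc0 : c 0 = 0 := by simp [c, hφ0]
        rw [ContinuousWithinAt, hc0]
        refine Tendsto.mono_left (tendsto_const_nhds.congr' ?_) nhdsWithin_le_nhds
        obtain ⟨R, hR⟩ := hc.isCompact.isBounded.subset_closedBall 0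
        have hev : ∀ᶠ s : ℝ in 𝓝[≠] 0, R ^ 2 + 1 < -Real.log s :=
          (tendsto_neg_atBot_atTop.comp Real.tendsto_log_nhdsNE_zero).eventually_gt_atTop _
        rw [eventually_nhdsWithin_iff] at hev
        filter_upwards [hev] with s hs1
        by_cases hs0 : s = 0
        · rw [hs0, hc0]
        · refine (image_eq_zero_of_notMem_tsupport (f := φ) fun hmem => ?_).symm
          have h1 := hR hmem
          simp only [Metric.mem_closedBall, dist_zero_right, Real.norm_eq_abs,
            abs_of_nonneg (Real.sqrt_nonneg _)] at h1
          have h2 := hs1 hs0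
          have h3 : Real.sqrt (-Real.log s) ^ 2 = -Real.log s :=
            Real.sq_sqrt (by nlinarith)
          nlinarith [Real.sqrt_nonneg (-Real.log s)]
      · refine ContinuousAt.continuousWithinAt ?_
        exact hφcont.continuousAt.comp
          (Real.continuous_sqrt.continuousAt.comp (Real.continuousAt_log hpos.ne').neg)
    obtain ⟨B, hB⟩ : ∃ B, ∀ r, |φ r| ≤ B := by
      obtain ⟨B, hB⟩ := hφcont.bounded_above_of_compact_support hc
      exact ⟨B, hB⟩
    have hφint := hint φ hφcont.measurable ⟨B, hB⟩
    have hbound : ∀ ε : ℝ, 0 < ε →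
        ‖∫ r in Ioi (0 : ℝ), φ r • g r‖ ≤ ε * ∫ r in Ioi (0 : ℝ), ‖g r‖ := by
      intro ε hε
      obtain ⟨q, hq⟩ := exists_polynomial_near_of_continuousOn 0 1 c hccont ε hε
      obtain ⟨D, hD⟩ := (isCompact_Icc (a := (0 : ℝ)) (b := 1)).exists_bound_of_continuousOn
        q.continuousOn
      have hqint := hint (fun r => q.eval (Real.exp (-r ^ 2)))
        (q.continuous.measurable.comp (by fun_prop)) ⟨D, fun r => hD _ (hle r)⟩
      rw [← sub_zero (∫ r in Ioi (0 : ℝ), φ r • g r), ← hpoly q, ← integral_sub hφint hqint,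
        ← integral_const_mul]
      refine norm_integral_le_of_norm_le (hg.norm.const_mul ε) ?_
      filter_upwards [ae_restrict_mem measurableSet_Ioi] with r hr
      rw [← sub_smul, norm_smul, ← hceq r hr, Real.norm_eq_abs, abs_sub_comm]
      gcongr
      exact (hq _ (hle r)).le
    have hI : 0 ≤ ∫ r in Ioi (0 : ℝ), ‖g r‖ := integral_nonneg fun r => norm_nonneg _
    rw [← norm_le_zero_iff]
    refine le_of_forall_pos_le_add fun δ hδ => ?_
    refine (hbound (δ / ((∫ r in Ioi (0 : ℝ), ‖g r‖) + 1)) (by positivity)).trans ?_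
    rw [div_mul_eq_mul_div, div_le_iff₀ (by positivity)]
    nlinarith
  rw [ae_restrict_iff' measurableSet_Ioi]
  filter_upwards [hmain] with r hr hr0
  have := hr hr0
  simpa [g, Real.exp_ne_zero] using this

end HalfLine

/-! ### Gaussian moments of radial Fourier pairs -/

section Radial

variable {n : ℕ} {P Q : ℝ → ℂ}

lemma IsTemperedFun.isTemperedIoi (hn : 1 ≤ n) (h : IsTemperedFun (radialFun n P)) :
    IsTemperedIoi fun r => (r ^ (n - 1) : ℝ) • P r := by
  have : Nonempty (Fin n) := ⟨⟨0, hn⟩⟩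
  obtain ⟨k, hk⟩ := h
  refine ⟨k, ?_⟩
  have := (integrable_fun_norm_addHaar (volume : Measure (Euc n))
    (f := fun r => (((1 + r) ^ k)⁻¹ : ℝ) • P r)).1 hk
  simp only [finrank_euclideanSpace, Fintype.card_fin] at this
  refine this.congr (Eventually.of_forall fun r => ?_)
  simp only [smul_smul]
  rw [mul_comm]

lemma IsTemperedFun.aemeasurable_profile (hn : 1 ≤ n) (h : IsTemperedFun (radialFun n P)) :
    AEMeasurable P (volume.restrict (Ioi 0)) := by
  have h1 := ((h.isTemperedIoi hn).integrableOn_gaussian_smul one_pos).aestronglyMeasurable.aemeasurable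
  have h2 : AEMeasurable (fun r : ℝ => (Real.exp (-1 * r ^ 2) * r ^ (n - 1))⁻¹)
      (volume.restrict (Ioi 0)) := by fun_prop
  refine (h2.smul h1).congr ?_
  filter_upwards [ae_restrict_mem measurableSet_Ioi] with r hr
  have hr' : (0 : ℝ) < r := hr
  simp only [Pi.smul_apply', smul_smul]
  rw [inv_mul_cancel₀ (by positivity), one_smul]

/-- Test with e^{-b|x|²}, whose transform is again a Gaussian; the constant n·vol(B) from polar
coordinates occurs on both sides and cancels. -/
lemma HasFourier.gaussMoment_eq (hn : 1 ≤ n) (h : HasFourier (radialFun n P) (radialFun n Q))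
    {b : ℝ} (hb : 0 < b) :
    gaussMoment (n - 1) Q b =
      (((Real.pi / b) ^ ((n : ℝ) / 2) : ℝ) : ℂ) * gaussMoment (n - 1) P (Real.pi ^ 2 / b) := by
  have : Nonempty (Fin n) := ⟨⟨0, hn⟩⟩
  have polar : ∀ (R : ℝ → ℂ) (c : ℝ),
      ∫ x : Euc n, radialFun n R x * ((Real.exp (-c * ‖x‖ ^ 2) : ℝ) : ℂ) =
        n • (volume : Measure (Euc n)).real (Metric.ball 0 1) • gaussMoment (n - 1) R c := by
    intro R c
    have := integral_fun_norm_addHaar (volume : Measure (Euc n))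
      (fun r => R r * ((Real.exp (-c * r ^ 2) : ℝ) : ℂ))
    simp only [finrank_euclideanSpace, Fintype.card_fin] at this
    rw [gaussMoment]
    refine this.trans ?_
    congr 3
    ext r
    simp only [Complex.real_smul]
    ring
  have h1 := h.2.2 (gaussianSchwartz n b hb)
  simp only [fourier_gaussianSchwartz, gaussianSchwartz_apply] at h1
  rw [polar] at h1
  have h2 : ∀ x : Euc n, radialFun n P x * ((((Real.pi / b) ^ ((n : ℝ) / 2) : ℝ) : ℂ) *
      ((Real.exp (-(Real.pi ^ 2 / b) * ‖x‖ ^ 2) : ℝ) : ℂ)) =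
      (((Real.pi / b) ^ ((n : ℝ) / 2) : ℝ) : ℂ) *
        (radialFun n P x * ((Real.exp (-(Real.pi ^ 2 / b) * ‖x‖ ^ 2) : ℝ) : ℂ)) := by
    intro x
    ring
  simp only [h2] at h1
  rw [integral_const_mul, polar] at h1
  have hvol : (volume : Measure (Euc n)).real (Metric.ball 0 1) ≠ 0 := by
    rw [measureReal_def]
    exact (ENNReal.toReal_pos (Metric.measure_ball_pos _ _ one_pos).ne' measure_ball_lt_top.ne).ne'
  have hn0 : (n : ℂ) ≠ 0 := by
    norm_cast
    lia
  have hvol' : (((volume : Measure (Euc n)).real (Metric.ball 0 1) : ℝ) : ℂ) ≠ 0 := by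
    exact_mod_cast hvol
  simp only [nsmul_eq_mul, Complex.real_smul] at h1
  apply mul_left_cancel₀ hn0
  apply mul_left_cancel₀ hvol'
  linear_combination -h1

end Radial

/-! ### From dimension N to dimension N + 2 -/

section DimensionShift

variable {N : ℕ} {U V : ℝ → ℂ}

/-- Integration by parts for the Gaussian moments of `V`, where `U' = r V`. -/
lemma gaussMoment_of_hasDerivAt (hN : 1 ≤ N)
    (hUV : ∀ r : ℝ, 0 < r → HasDerivAt U ((r : ℂ) * V r) r)
    (h0 : Tendsto (fun r : ℝ => U r * ((r ^ N : ℝ) : ℂ)) (𝓝[>] 0) (𝓝 0))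
    (hinf : Tendsto (fun r : ℝ => U r * ((r ^ (((N : ℝ) - 1) / 2) : ℝ) : ℂ)) atTop (𝓝 0))
    (hU : IsTemperedIoi fun r => (r ^ (N - 1) : ℝ) • U r)
    (hV : IsTemperedIoi fun r => (r ^ (N + 1) : ℝ) • V r) {c : ℝ} (hc : 0 < c) :
    gaussMoment (N + 1) V c =
      -N * gaussMoment (N - 1) U c + 2 * c * gaussMoment (N + 1) U c := by
  -- Only r^N is kept in the weight: the remaining r of r^{N+1} V completes rV = U'.
  let w : ℝ → ℝ := fun r => r ^ N * Real.exp (-c * r ^ 2)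
  let w' : ℝ → ℝ := fun r => N * r ^ (N - 1) * Real.exp (-c * r ^ 2) +
    r ^ N * (Real.exp (-c * r ^ 2) * (-c * (2 * r)))
  have hw : ∀ r, HasDerivAt w (w' r) r := by
    intro r
    have h1 : HasDerivAt (fun r : ℝ => -c * r ^ 2) (-c * (2 * r)) r := by
      simpa using (hasDerivAt_pow 2 r).const_mul (-c)
    exact (hasDerivAt_pow N r).mul h1.exp
  have hU1 := hU.integrableOn_gaussian_smul hc
  have hU2' : IsTemperedIoi fun r => (r ^ (N + 1) : ℝ) • U r := by
    convert hU.pow_smul 2 using 2 with r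
    rw [smul_smul, ← pow_add]
    congr 2
    lia
  have hU2 := hU2'.integrableOn_gaussian_smul hc
  have hV1 := hV.integrableOn_gaussian_smul hc
  have e1 : ∀ r, ((w' r : ℝ) : ℂ) * U r =
      (N : ℂ) * (Real.exp (-c * r ^ 2) • ((r ^ (N - 1) : ℝ) • U r)) +
        (-2 * c) * (Real.exp (-c * r ^ 2) • ((r ^ (N + 1) : ℝ) • U r)) := by
    intro r
    simp only [w', Complex.real_smul]
    push_cast
    ring
  have e2 : ∀ r, ((w r : ℝ) : ℂ) * ((r : ℂ) * V r) =
      Real.exp (-c * r ^ 2) • ((r ^ (N + 1) : ℝ) • V r) := by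
    intro r
    simp only [w, Complex.real_smul]
    push_cast
    ring
  have hzero : Tendsto ((fun r => ((w r : ℝ) : ℂ)) * U) (𝓝[>] 0) (𝓝 0) := by
    have h1 : Tendsto (fun r : ℝ => ((Real.exp (-c * r ^ 2) : ℝ) : ℂ)) (𝓝[>] 0)
        (𝓝 ((Real.exp (-c * 0 ^ 2) : ℝ) : ℂ)) :=
      (Continuous.tendsto (by fun_prop) 0).mono_left nhdsWithin_le_nhds
    have h2 := h0.mul h1
    rw [zero_mul] at h2
    refine h2.congr fun r => ?_
    simp only [w, Pi.mul_apply]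
    push_cast
    ring
  have htop : Tendsto ((fun r => ((w r : ℝ) : ℂ)) * U) atTop (𝓝 0) := by
    -- A bounded weight suffices: for r ≥ 1 the factor r^{(N-1)/2} is at least 1, so U itself tends
    -- to 0.
    obtain ⟨C, hC⟩ := exists_one_add_pow_mul_exp_le N hc
    have h1 := hinf.norm.const_mul C
    rw [norm_zero, mul_zero] at h1
    refine squeeze_zero_norm' ?_ h1
    filter_upwards [eventually_ge_atTop 1] with r hr
    have hN' : (1 : ℝ) ≤ N := by exact_mod_cast hN
    have hr1 : 1 ≤ r ^ (((N : ℝ) - 1) / 2) := Real.one_le_rpow hr (by linarith)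
    have hw0 : 0 ≤ w r := by positivity
    have hwC : w r ≤ C := by
      refine le_trans ?_ (hC r (by linarith))
      simp only [w]
      gcongr
      linarith
    rw [Pi.mul_apply, norm_mul, norm_mul, Complex.norm_real, Complex.norm_real,
      Real.norm_of_nonneg hw0, Real.norm_of_nonneg (by linarith)]
    calc w r * ‖U r‖ ≤ C * ‖U r‖ := by gcongr
      _ ≤ C * (‖U r‖ * r ^ (((N : ℝ) - 1) / 2)) := by
        have : 0 ≤ C := hw0.trans hwC
        gcongr
        exact le_mul_of_one_le_right (norm_nonneg _) hr1
  have parts := integral_Ioi_mul_deriv_eq_deriv_mul (a := 0) (a' := 0) (b' := 0)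
    (u := fun r => ((w r : ℝ) : ℂ)) (u' := fun r => ((w' r : ℝ) : ℂ)) (v := U)
    (v' := fun r => (r : ℂ) * V r) (fun r _ => (hw r).ofReal_comp) (fun r hr => hUV r hr)
    (by
      refine hV1.congr (Eventually.of_forall fun r => ?_)
      rw [Pi.mul_apply, e2])
    (by
      refine ((hU1.const_mul (N : ℂ)).add (hU2.const_mul (-2 * c : ℂ))).congr
        (Eventually.of_forall fun r => ?_)
      simp only [Pi.mul_apply, Pi.add_apply]
      rw [e1])
    hzero htop
  simp only [e1, e2] at parts
  rw [integral_add (hU1.const_mul _) (hU2.const_mul _), integral_const_mul,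
    integral_const_mul] at parts
  unfold gaussMoment
  linear_combination parts

/-- The profiles of the Fourier transforms of `u` and `v` differ by the factor `-2π`. -/
lemma fourier_profile_eq (hN : 1 ≤ N)
    (hUV : ∀ r : ℝ, 0 < r → HasDerivAt U ((r : ℂ) * V r) r)
    (h0 : Tendsto (fun r : ℝ => U r * ((r ^ N : ℝ) : ℂ)) (𝓝[>] 0) (𝓝 0))
    (hinf : Tendsto (fun r : ℝ => U r * ((r ^ (((N : ℝ) - 1) / 2) : ℝ) : ℂ)) atTop (𝓝 0))
    {F G : ℝ → ℂ} (hF : HasFourier (radialFun N U) (radialFun N F))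
    (hG : HasFourier (radialFun (N + 2) V) (radialFun (N + 2) G)) :
    ∀ᵐ r ∂volume.restrict (Ioi 0), G r = -2 * (Real.pi : ℂ) * F r := by
  have hU' := hF.1.isTemperedIoi hN
  have hF' := hF.2.1.isTemperedIoi hN
  have hV' := hG.1.isTemperedIoi (by lia)
  have hG' := hG.2.1.isTemperedIoi (by lia)
  have hN2 : N + 2 - 1 = N + 1 := by lia
  have hN1 : N - 1 + 2 = N + 1 := by lia
  rw [hN2] at hV' hG'
  have hF2 : IsTemperedIoi fun r => (r ^ (N + 1) : ℝ) • F r := by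
    convert hF'.pow_smul 2 using 2 with r
    rw [smul_smul, ← pow_add]
    congr 2
    lia
  have hmoment : ∀ b : ℝ, 0 < b →
      gaussMoment (N + 1) G b = -2 * (Real.pi : ℂ) * gaussMoment (N + 1) F b := by
    intro b hb
    have hc : 0 < Real.pi ^ 2 / b := by positivity
    have hGb := hG.gaussMoment_eq (by lia) hb
    rw [hN2, gaussMoment_of_hasDerivAt hN hUV h0 hinf hU' hV' hc] at hGb
    have d1 := hasDerivAt_gaussMoment hF' hb
    rw [hN1] at d1
    have d2 : HasDerivAt (fun b => gaussMoment (N - 1) U (Real.pi ^ 2 / b))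
        ((-(Real.pi ^ 2 / b ^ 2) : ℝ) • -gaussMoment (N + 1) U (Real.pi ^ 2 / b)) b := by
      have h1 := hasDerivAt_gaussMoment hU' hc
      rw [hN1] at h1
      have h2 : HasDerivAt (fun b : ℝ => Real.pi ^ 2 / b) (-(Real.pi ^ 2 / b ^ 2)) b := by
        simpa [div_eq_mul_inv] using (hasDerivAt_inv hb.ne').const_mul (Real.pi ^ 2)
      exact HasDerivAt.scomp b h1 h2
    have d3 : HasDerivAt (fun b : ℝ => (Real.pi / b) ^ ((N : ℝ) / 2))
        (-((N : ℝ) / 2 / b) * (Real.pi / b) ^ ((N : ℝ) / 2)) b := by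
      have h1 : HasDerivAt (fun b : ℝ => Real.pi / b) (-(Real.pi / b ^ 2)) b := by
        simpa [div_eq_mul_inv] using (hasDerivAt_inv hb.ne').const_mul Real.pi
      convert h1.rpow_const (p := (N : ℝ) / 2) (Or.inl (by positivity)) using 1
      rw [Real.rpow_sub_one (by positivity)]
      field_simp
    have d4 := d3.ofReal_comp.mul d2
    have heq : gaussMoment (N - 1) F =ᶠ[𝓝 b] fun b =>
        (((Real.pi / b) ^ ((N : ℝ) / 2) : ℝ) : ℂ) * gaussMoment (N - 1) U (Real.pi ^ 2 / b) := by
      filter_upwards [Ioi_mem_nhds hb] with x hx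
      exact hF.gaussMoment_eq hN hx
    -- Two values of the derivative of b ↦ M_{N-1}(F, b): -M_{N+1}(F, b), and the product rule
    -- applied to (π/b)^{N/2} M_{N-1}(U, π²/b).
    have hd := (d1.congr_of_eventuallyEq heq.symm).unique d4
    have hpow : (Real.pi / b) ^ (((N + 2 : ℕ) : ℝ) / 2) =
        (Real.pi / b) ^ ((N : ℝ) / 2) * (Real.pi / b) := by
      rw [← Real.rpow_add_one (by positivity)]
      congr 1
      push_cast
      ring
    rw [hGb, hpow]
    rw [neg_eq_iff_eq_neg] at hd
    rw [hd]
    have hbC : (b : ℂ) ≠ 0 := by exact_mod_cast hb.ne'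
    simp only [Complex.real_smul]
    push_cast
    field_simp
  -- The function with vanishing Gaussian moments is r^{N+1}(G + 2πF).
  have hsum := hG'.add (hF2.const_smul (2 * (Real.pi : ℂ)))
  have hz := hsum.ae_eq_zero_of_gaussMoment fun b hb => by
    have h1 := hmoment b hb
    simp only [smul_add]
    rw [integral_add (hG'.integrableOn_gaussian_smul hb)
      ((hF2.const_smul _).integrableOn_gaussian_smul hb)]
    have h2 : ∀ r : ℝ, Real.exp (-b * r ^ 2) • (2 * (Real.pi : ℂ) * ((r ^ (N + 1) : ℝ) • F r)) =
        2 * (Real.pi : ℂ) * (Real.exp (-b * r ^ 2) • ((r ^ (N + 1) : ℝ) • F r)) := fun r =>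
      (mul_smul_comm _ _ _).symm
    simp only [h2]
    rw [integral_const_mul]
    unfold gaussMoment at h1
    rw [h1]
    ring
  filter_upwards [hz, ae_restrict_mem measurableSet_Ioi] with r hr hr0
  have hr' : ((r : ℂ)) ^ (N + 1) ≠ 0 := by
    have : (r : ℂ) ≠ 0 := by exact_mod_cast (ne_of_gt hr0)
    positivity
  simp only [Complex.real_smul] at hr
  push_cast at hr
  apply mul_left_cancel₀ hr'
  linear_combination hr

end DimensionShift

/-! ### Continuous profiles, fractional Laplacians and the main theorem -/

lemma fourier_radialFun_eq_of_norm_eq {n : ℕ} (P : ℝ → ℂ) {x y : Euc n} (h : ‖x‖ = ‖y‖) :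
    𝓕 (radialFun n P) x = 𝓕 (radialFun n P) y := by
  obtain ⟨A, rfl⟩ := exists_linearIsometryEquiv_apply_eq h
  rw [← Real.fourier_comp_linearIsometry]
  have hA : radialFun n P ∘ A = radialFun n P := by
    ext z
    simp [radialFun]
  rw [hA]

/-- The Fourier transform of an integrable radial function has a continuous profile. -/
lemma exists_continuous_fourier_profile {n : ℕ} (hn : 1 ≤ n) {P : ℝ → ℂ}
    (h : Integrable (radialFun n P)) :
    ∃ F : ℝ → ℂ, Continuous F ∧ 𝓕 (radialFun n P) = radialFun n F := by
  let e : Euc n := EuclideanSpace.single ⟨0, hn⟩ 1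
  refine ⟨fun r => 𝓕 (radialFun n P) (r • e), h.continuous_fourier.comp (by fun_prop), ?_⟩
  ext x
  exact fourier_radialFun_eq_of_norm_eq P (by simp [e, norm_smul])

lemma HasFourier.hasFourier_of_hasFracLaplacian {n : ℕ} {s : ℝ} {φ w f : Euc n → ℂ}
    (hf : HasFourier φ f) (h : HasFracLaplacian s φ w) :
    HasFourier w (fun ξ => (((2 * Real.pi * ‖ξ‖) ^ (2 * s) : ℝ) : ℂ) * f ξ) := by
  obtain ⟨g, hg, hw⟩ := h
  refine hw.congr EventuallyEq.rfl ?_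
  filter_upwards [hg.unique_right hf] with ξ hξ
  rw [hξ]

lemma HasFourier.aestronglyMeasurable_multiplier {n : ℕ} {φ f : Euc n → ℂ}
    (hf : HasFourier φ f) (s : ℝ) :
    AEStronglyMeasurable (fun ξ => (((2 * Real.pi * ‖ξ‖) ^ (2 * s) : ℝ) : ℂ) * f ξ) := by
  have : Measurable fun ξ : Euc n => (((2 * Real.pi * ‖ξ‖) ^ (2 * s) : ℝ) : ℂ) :=
    Complex.measurable_ofReal.comp (by fun_prop)
  exact this.aestronglyMeasurable.mul hf.2.1.aestronglyMeasurable

/-- `Δ^s φ` exists in `L²` exactly when the corresponding multiplier of `𝓕 φ` is in `L²`. -/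
lemma HasFourier.exists_memLp_fracLaplacian_iff {n : ℕ} {φ f : Euc n → ℂ} (hf : HasFourier φ f)
    (s : ℝ) : (∃ w, MemLp w 2 volume ∧ HasFracLaplacian s φ w) ↔
      ∫⁻ ξ, ‖(((2 * Real.pi * ‖ξ‖) ^ (2 * s) : ℝ) : ℂ) * f ξ‖ₑ ^ 2 < ∞ := by
  rw [← memLp_two_iff (hf.aestronglyMeasurable_multiplier s)]
  constructor
  · rintro ⟨w, hw, hs⟩
    exact (hf.hasFourier_of_hasFracLaplacian hs).memLp_right hw
  · intro h
    obtain ⟨w, hw, hwf⟩ := h.exists_hasFourier_left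
    exact ⟨w, hw, f, hf, hwf⟩

/-- In polar coordinates the integrands agree: raising the order by 1/2 multiplies the squared
multiplier by (2πr)², where 4π² matches |-2π|² and r² matches r^{N+1}/r^{N-1}. Only the sphere areas
differ. -/
lemma lintegral_multiplier_eq {N : ℕ} (hN : 1 ≤ N) {Φ : ℝ → ℂ}
    (hΦ : AEMeasurable Φ (volume.restrict (Ioi 0))) (α : ℝ) :
    ∫⁻ ξ : Euc N, ‖(((2 * Real.pi * ‖ξ‖) ^ (2 * (α + 1 / 2)) : ℝ) : ℂ) * radialFun N Φ ξ‖ₑ ^ 2 =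
      sphereArea N / sphereArea (N + 2) * ∫⁻ η : Euc (N + 2),
        ‖(((2 * Real.pi * ‖η‖) ^ (2 * α) : ℝ) : ℂ) *
          radialFun (N + 2) (fun r => -2 * (Real.pi : ℂ) * Φ r) η‖ₑ ^ 2 := by
  have hmul : ∀ s : ℝ, AEMeasurable (fun r : ℝ => (((2 * Real.pi * r) ^ (2 * s) : ℝ) : ℂ))
      (volume.restrict (Ioi 0)) := fun s =>
    (Complex.measurable_ofReal.comp (by fun_prop)).aemeasurable
  have h1 := lintegral_norm hN
    (F := fun r => ‖(((2 * Real.pi * r) ^ (2 * (α + 1 / 2)) : ℝ) : ℂ) * Φ r‖ₑ ^ 2)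
    (((hmul _).mul hΦ).enorm.pow_const 2)
  have h2 := lintegral_norm (n := N + 2) (by lia)
    (F := fun r => ‖(((2 * Real.pi * r) ^ (2 * α) : ℝ) : ℂ) * (-2 * (Real.pi : ℂ) * Φ r)‖ₑ ^ 2)
    (((hmul _).mul (hΦ.const_mul _)).enorm.pow_const 2)
  refine h1.trans ?_
  rw [show ∫⁻ η : Euc (N + 2), ‖(((2 * Real.pi * ‖η‖) ^ (2 * α) : ℝ) : ℂ) *
    radialFun (N + 2) (fun r => -2 * (Real.pi : ℂ) * Φ r) η‖ₑ ^ 2 = _ from h2, ← mul_assoc,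
    ENNReal.div_mul_cancel (sphereArea_ne_zero (by lia)) (sphereArea_ne_top _)]
  congr 1
  refine setLIntegral_congr_fun measurableSet_Ioi fun r hr => ?_
  have hr' : (0 : ℝ) < r := hr
  simp only [← ofReal_norm, norm_mul, Complex.norm_real, norm_neg, Complex.norm_ofNat]
  rw [← ENNReal.ofReal_pow (by positivity), ← ENNReal.ofReal_pow (by positivity),
    ← ENNReal.ofReal_mul (by positivity), ← ENNReal.ofReal_mul (by positivity)]
  congr 1
  have e1 : (2 * Real.pi * r) ^ (2 * (α + 1 / 2)) =
      (2 * Real.pi * r) ^ (2 * α) * (2 * Real.pi * r) := by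
    rw [← Real.rpow_add_one (by positivity)]
    congr 1
    ring
  obtain ⟨M, rfl⟩ : ∃ M, N = M + 1 := ⟨N - 1, by lia⟩
  rw [e1, norm_mul, Real.norm_of_nonneg (by positivity : 0 ≤ 2 * Real.pi * r),
    Real.norm_of_nonneg Real.pi_pos.le]
  simp only [add_tsub_cancel_right, show M + 1 + 2 - 1 = M + 2 by lia]
  ring

theorem mainTheorem5 (N : ℕ) (hN : 1 ≤ N) (U V : ℝ → ℂ)
    (hUV : ∀ r : ℝ, 0 < r → HasDerivAt U ((r : ℂ) * V r) r)
    (h0 : Tendsto (fun r : ℝ => U r * ((r ^ N : ℝ) : ℂ)) (𝓝[>] 0) (𝓝 0))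
    (hinf : Tendsto (fun r : ℝ => U r * ((r ^ (((N : ℝ) - 1) / 2) : ℝ) : ℂ)) atTop (𝓝 0)) :
    -- the Fourier transforms as absolutely convergent integrals: equality at every frequency
    (Integrable (radialFun N U) → Integrable (radialFun (N + 2) V) →
      ∀ (ξ : Euc N) (η : Euc (N + 2)), ‖η‖ = ‖ξ‖ →
        𝓕 (radialFun (N + 2) V) η = -2 * (Real.pi : ℂ) * 𝓕 (radialFun N U) ξ) ∧
    -- the Fourier transforms of tempered functions
    (∀ (f : Euc N → ℂ) (g : Euc (N + 2) → ℂ),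
      HasFourier (radialFun N U) f → HasFourier (radialFun (N + 2) V) g →
      (∃ Φ : ℝ → ℂ, f =ᵐ[volume] radialFun N Φ ∧
        g =ᵐ[volume] radialFun (N + 2) (fun r => -2 * (Real.pi : ℂ) * Φ r)) ∧
      ∀ α : ℝ, 0 ≤ α →
        ((∃ w, MemLp w 2 volume ∧ HasFracLaplacian (α + 1 / 2) (radialFun N U) w) ↔
          ∃ z, MemLp z 2 volume ∧ HasFracLaplacian α (radialFun (N + 2) V) z) ∧
        ∀ w z, HasFracLaplacian (α + 1 / 2) (radialFun N U) w →
          HasFracLaplacian α (radialFun (N + 2) V) z →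
          ∫⁻ x, ‖w x‖ₑ ^ 2 = sphereArea N / sphereArea (N + 2) * ∫⁻ y, ‖z y‖ₑ ^ 2) := by
  refine ⟨fun hu hv ξ η hηξ => ?_, fun f g hf hg => ?_⟩
  · obtain ⟨F, hFc, hF⟩ := exists_continuous_fourier_profile hN hu
    obtain ⟨G, hGc, hG⟩ := exists_continuous_fourier_profile (by lia) hv
    have hae := fourier_profile_eq hN hUV h0 hinf (hF ▸ hu.hasFourier) (hG ▸ hv.hasFourier)
    have hc : Continuous fun r => -2 * (Real.pi : ℂ) * F r := by fun_prop
    have heq : EqOn G (fun r => -2 * (Real.pi : ℂ) * F r) (Ioi 0) :=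
      Measure.eqOn_open_of_ae_eq hae isOpen_Ioi hGc.continuousOn hc.continuousOn
    -- Passing to the closure adds r = 0, that is, the zero frequency.
    have heq' := heq.closure hGc hc
    rw [closure_Ioi] at heq'
    rw [hF, hG, radialFun, radialFun, ← hηξ]
    exact heq' (norm_nonneg η)
  · obtain ⟨Φ, hΦ⟩ := hf.exists_radial hN
    obtain ⟨Γ, hΓ⟩ := hg.exists_radial (by lia)
    have hf' := hf.congr EventuallyEq.rfl hΦ
    have hae := fourier_profile_eq hN hUV h0 hinf hf' (hg.congr EventuallyEq.rfl hΓ)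
    have hΓ' : g =ᵐ[volume] radialFun (N + 2) (fun r => -2 * (Real.pi : ℂ) * Φ r) :=
      hΓ.trans (ae_norm_of_ae_Ioi (by lia) hae)
    have hg' := hg.congr EventuallyEq.rfl hΓ'
    refine ⟨⟨Φ, hΦ, hΓ'⟩, fun α _ => ?_⟩
    have key := lintegral_multiplier_eq hN (hf'.2.1.aemeasurable_profile hN) α
    constructor
    · rw [hf'.exists_memLp_fracLaplacian_iff, hg'.exists_memLp_fracLaplacian_iff, key]
      have hr0 : sphereArea N / sphereArea (N + 2) ≠ 0 :=
        ENNReal.div_ne_zero.2 ⟨sphereArea_ne_zero hN, sphereArea_ne_top _⟩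
      have hrt : sphereArea N / sphereArea (N + 2) ≠ ∞ :=
        ENNReal.div_ne_top (sphereArea_ne_top _) (sphereArea_ne_zero (by lia))
      rw [ENNReal.mul_lt_top_iff]
      constructor
      · rintro (h | h | h)
        · exact h.2
        · exact absurd h hr0
        · exact h ▸ ENNReal.zero_lt_top
      · exact fun h => Or.inl ⟨hrt.lt_top, h⟩
    · intro w z hw hz
      rw [(hf'.hasFourier_of_hasFracLaplacian hw).lintegral_sq_eq,
        (hg'.hasFourier_of_hasFracLaplacian hz).lintegral_sq_eq, key]
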